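/- For a domain (nonempty connected open set) $D\subset\mathbb C^n$, let $d_D(z)$ denote the Euclidean distance of $z\in D$ to $\partial D$; $D$ is pseudoconvex if $-\log d_D$ is plurisubharmonic on $D$, and it is a Reinhardt domain if $(\lambda_1z_1,\dots,\lambda_nz_n)\in D$ whenever $z\in D$ and $|\lambda_1|=\dots=|\lambda_n|=1$. Let $\mathbb D\subset\mathbb C$ be the unit disc, $p(\lambda,\mu)=\tanh^{-1}\left|\frac{\lambda-\mu}{1-\overline\mu\lambda}\right|$ the Poincaré distance on $\mathbb D$, and $$\widetilde k_D(w,z)=\inf\{p(\lambda,\mu):\lambda,\mu\in\mathbb D\text{ and there is a holomorphic } f:\mathbb D\to D\text{ with }f(\lambda)=w,\ f(\mu)=z\}$$ the Lempert function of $D$. The Kobayashi pseudodistance $k_D(w,z)$ is the supremum of $\rho_D(w,z)$ over all families $(\rho_G)_G$ of pseudodistances on the domains $G\subset\mathbb C^m$, $m\ge 0$, that are not increased by holomorphic maps between domains and satisfy $\rho_G\le\widetilde k_G$ for every $G$. **Theorem.** Let $D\subset\mathbb C^n$ be a pseudoconvex Reinhardt domain, and fix $z_0\in D$ and $\zeta_0\in\partial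 D$. Then there are a constant $C\in\mathbb R$ and a neighbourhood $U$ of $\zeta_0$ such that $$k_D(z_0,z)\le-\log d_D(z)+C\qquad\text{for all } z\in D\cap U.$$ If moreover all coordinates of $\zeta_0$ are nonzero, then there are a constant $C'\in\mathbb R$ and a neighbourhood $U'$ of $\zeta_0$ such that $$k_D(z_0,z)\le-\tfrac12\log d_D(z)+C'\qquad\text{for all } z\in D\cap U'.$$ -/

import Mathlib

open scoped ENNReal Topology

noncomputable section

namespace KobReinhardt

/-- `ℂⁿ` with its Euclidean norm. -/
abbrev Cn (n : ℕ) : Type := EuclideanSpace ℂ (Fin n)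

/-- A domain in `ℂⁿ`: a nonempty connected open set. -/
def IsDom {n : ℕ} (D : Set (Cn n)) : Prop :=
  IsOpen D ∧ IsConnected D

/-- Reinhardt domain: a domain that is invariant under rotations of the coordinates. -/
def IsReinhardtDomain {n : ℕ} (D : Set (Cn n)) : Prop :=
  IsDom D ∧
    ∀ l : Fin n → ℂ, (∀ j, ‖l j‖ = 1) → ∀ z ∈ D, WithLp.toLp 2 (fun j => l j * z j) ∈ D

/-- `d_D(z)`, the Euclidean distance of `z` to the boundary of `D`. -/
def bdist {n : ℕ} (D : Set (Cn n)) (z : Cn n) : ℝ :=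
  Metric.infDist z (frontier D)

/-- Continuous real-valued plurisubharmonic functions on `D`: the restriction to every complex
line satisfies the sub-mean value inequality on all closed discs contained in `D`
(the radius of the disc is `‖w‖`). -/
def IsContPSHOn {n : ℕ} (u : Cn n → ℝ) (D : Set (Cn n)) : Prop :=
  ContinuousOn u D ∧
    ∀ z w : Cn n, (∀ l : ℂ, ‖l‖ ≤ 1 → z + l • w ∈ D) →
      u z ≤ Real.circleAverage (fun l : ℂ => u (z + l • w)) 0 1

/-- Pseudoconvexity: `-log d_D` is plurisubharmonic on `D` (it is automatically continuous).
For `D = ℂⁿ`, where the boundary is empty, `bdist D` is constant in Lean, and so `ℂⁿ` is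
pseudoconvex, as it should be. -/
def IsPseudoconvex {n : ℕ} (D : Set (Cn n)) : Prop :=
  IsContPSHOn (fun z => -Real.log (bdist D z)) D

/-- The Poincaré distance `p(l, m) = artanh |(l - m) / (1 - conj(m) l)|` of the unit disc. -/
def poincare (l m : ℂ) : ℝ :=
  1 / 2 * Real.log
    ((1 + ‖(l - m) / (1 - (starRingEnd ℂ) m * l)‖) /
      (1 - ‖(l - m) / (1 - (starRingEnd ℂ) m * l)‖))

/-- The Lempert function: the infimum of `p(l, m)` over all holomorphic discs `f` in `D` with
`f l = w` and `f m = z` (it is `∞` if there is no such disc). -/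
def lempert {n : ℕ} (D : Set (Cn n)) (w z : Cn n) : ℝ≥0∞ :=
  ⨅ (f : ℂ → Cn n) (l : ℂ) (m : ℂ)
    (_ : DifferentiableOn ℂ f (Metric.ball 0 1) ∧ Set.MapsTo f (Metric.ball 0 1) D ∧
      l ∈ Metric.ball (0 : ℂ) 1 ∧ m ∈ Metric.ball (0 : ℂ) 1 ∧ f l = w ∧ f m = z),
    ENNReal.ofReal (poincare l m)

/-- `d` is a pseudodistance on the set `D`. -/
def IsPseudodistOn {n : ℕ} (d : Cn n → Cn n → ℝ) (D : Set (Cn n)) : Prop :=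
  (∀ z ∈ D, d z z = 0) ∧
  (∀ w ∈ D, ∀ z ∈ D, 0 ≤ d w z) ∧
  (∀ w ∈ D, ∀ z ∈ D, d w z = d z w) ∧
  (∀ w ∈ D, ∀ y ∈ D, ∀ z ∈ D, d w z ≤ d w y + d y z)

/-- A holomorphically invariant family of pseudodistances, one on each domain of each `ℂⁿ`:
holomorphic maps between domains do not increase them. -/
def IsInvariantFamily (d : (n : ℕ) → Set (Cn n) → Cn n → Cn n → ℝ) : Prop :=
  (∀ (n : ℕ) (D : Set (Cn n)), IsDom D → IsPseudodistOn (d n D) D) ∧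
  (∀ (n m : ℕ) (D : Set (Cn n)) (G : Set (Cn m)), IsDom D → IsDom G →
    ∀ F : Cn n → Cn m, DifferentiableOn ℂ F D → Set.MapsTo F D G →
      ∀ w ∈ D, ∀ z ∈ D, d m G (F w) (F z) ≤ d n D w z)

/-- The family `d` does not exceed the Lempert function on any domain. -/
def LeLempert (d : (n : ℕ) → Set (Cn n) → Cn n → Cn n → ℝ) : Prop :=
  ∀ (n : ℕ) (D : Set (Cn n)), IsDom D →
    ∀ w ∈ D, ∀ z ∈ D, ENNReal.ofReal (d n D w z) ≤ lempert D w z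

/-- The Kobayashi pseudodistance `k_D`: the supremum of `d_D` over all holomorphically invariant
families of pseudodistances that do not exceed the Lempert function. -/
def kobayashi {n : ℕ} (D : Set (Cn n)) (w z : Cn n) : ℝ≥0∞ :=
  ⨆ (d : (n : ℕ) → Set (Cn n) → Cn n → Cn n → ℝ) (_ : IsInvariantFamily d ∧ LeLempert d),
    ENNReal.ofReal (d n D w z)

end KobReinhardt

end

/-! The modulus of `exp a` depends only on `Re a`, so the coordinatewise exponential maps the tube
over `logImage D` into `D`. Pseudoconvexity makes `logImage D` convex
(`IsReinhardtDomain.segment_subset`). Prolong the segment from `x₀` to `x = (log |z j|)` by the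
fractions `r` beyond `x₀` and `s` beyond `x`. The exponential of a complex affine disc over the
longer segment is a disc in `D` through a point over `x₀` and through `z`, of Poincaré cost at most
`½ log (9 / (r s))` (`IsReinhardtDomain.kobBound_expPt`). The points over `x₀` form a compact torus,
which is at bounded cost from `z₀`.

Here `s` can be a fixed multiple of `d_D(z)` (`abs_exp_add_mul_sub_exp_le`), while `r` is of order
`1 / ‖x - x₀‖`. If `ζ₀` has no zero coordinate, `x` stays bounded and only `s` matters: this gives
`-½ log d_D`. Otherwise `z` is first moved, at bounded cost, to a point whose coordinates are at
least a constant times `d_D(z)`. Then `‖x - x₀‖` is `O(1 / d_D(z))`, and `r` contributes at most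
another `-½ log d_D`.

Convexity is a continuity principle: `-log d_D` satisfies a maximum principle along segments of
`logImage D` (`LogSubMean.le_of_segment`), so segments cannot approach the boundary while their
endpoints stay away from it. -/

namespace KobReinhardt

/-! ### Upper bounds for the Kobayashi pseudodistance by chains of discs -/

open Metric Set Filter

/-- Every invariant family of pseudodistances below the Lempert function is at most `c` at
`(w, z)`. -/
def KobBound {n : ℕ} (D : Set (Cn n)) (w z : Cn n) (c : ℝ) : Prop :=
  ∀ d, IsInvariantFamily d → LeLempert d → d n D w z ≤ c

variable {n : ℕ} {D : Set (Cn n)}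

theorem KobBound.mono {w z : Cn n} {c c' : ℝ} (h : KobBound D w z c) (hc : c ≤ c') :
    KobBound D w z c' := fun d h1 h2 => (h d h1 h2).trans hc

theorem KobBound.symm (hD : IsDom D) {w z : Cn n} (hw : w ∈ D) (hz : z ∈ D) {c : ℝ}
    (h : KobBound D w z c) : KobBound D z w c := fun d h1 h2 => by
  rw [(h1.1 n D hD).2.2.1 z hz w hw]
  exact h d h1 h2

theorem KobBound.trans (hD : IsDom D) {w y z : Cn n} (hw : w ∈ D) (hy : y ∈ D) (hz : z ∈ D)
    {c c' : ℝ} (h : KobBound D w y c) (h' : KobBound D y z c') : KobBound D w z (c + c') :=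
  fun d h1 h2 => ((h1.1 n D hD).2.2.2 w hw y hy z hz).trans (add_le_add (h d h1 h2) (h' d h1 h2))

theorem KobBound.of_disc (hD : IsDom D) {f : ℂ → Cn n} (hf : DifferentiableOn ℂ f (ball 0 1))
    (hfD : MapsTo f (ball 0 1) D) {l m : ℂ} (hl : l ∈ ball (0 : ℂ) 1) (hm : m ∈ ball (0 : ℂ) 1)
    {c : ℝ} (hc : 0 ≤ c) (hp : poincare l m ≤ c) : KobBound D (f l) (f m) c := fun d _ h2 => by
  have h := h2 n D hD (f l) (hfD hl) (f m) (hfD hm)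
  have h' : lempert D (f l) (f m) ≤ ENNReal.ofReal (poincare l m) :=
    iInf_le_of_le f <| iInf_le_of_le l <| iInf_le_of_le m <|
      iInf_le_of_le ⟨hf, hfD, hl, hm, rfl, rfl⟩ le_rfl
  exact (ENNReal.ofReal_le_ofReal_iff hc).1 ((h.trans h').trans (ENNReal.ofReal_le_ofReal hp))

/-- The value of `poincare 0 (1 / 2)`. -/
theorem poincare_zero_half : poincare 0 (1 / 2) = 1 / 2 * Real.log 3 := by
  simp only [poincare, mul_zero, sub_zero, zero_sub, div_one, norm_neg]
  norm_num

theorem KobBound.of_ball (hD : IsDom D) {z y : Cn n} {r : ℝ} (hr : 0 < r) (h : ball z r ⊆ D)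
    (hy : ‖y - z‖ ≤ r / 2) : KobBound D z y (1 / 2 * Real.log 3) := by
  -- The disc has radius `2 ‖y - z‖ ≤ r` and reaches `y` at parameter `1 / 2`.
  have key := KobBound.of_disc (f := fun l : ℂ => z + l • ((2 : ℂ) • (y - z))) (l := 0)
    (m := 1 / 2) hD (by fun_prop) ?_ (by simp) (by norm_num)
    (by have := Real.log_nonneg (x := 3) (by norm_num); positivity) poincare_zero_half.le
  · simpa [smul_smul] using key
  · intro l hl
    apply h
    rw [mem_ball_zero_iff] at hl
    rw [mem_ball, dist_eq_norm, add_sub_cancel_left, norm_smul, norm_smul]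
    norm_num
    nlinarith [norm_nonneg l, norm_nonneg (y - z)]

/-- A connectedness argument: the points with a locally uniform bound form an open set, which
contains its limit points in `D` because passing to a nearby point costs at most `½ log 3`. -/
theorem exists_kobBound_nhds (hD : IsDom D) {z₀ z : Cn n} (hz₀ : z₀ ∈ D) (hz : z ∈ D) :
    ∃ c : ℝ, ∀ᶠ y in 𝓝 z, KobBound D z₀ y c := by
  have step : ∀ z ∈ D, ∃ r > 0, ball z r ⊆ D ∧ ∀ y ∈ ball z r, y ∈ D ∧
      KobBound D z y (1 / 2 * Real.log 3) := by
    intro z hz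
    obtain ⟨r, hr, hb⟩ := Metric.isOpen_iff.1 hD.1 z hz
    refine ⟨r / 2, by positivity, (ball_subset_ball (by linarith)).trans hb, fun y hy => ?_⟩
    refine ⟨hb (ball_subset_ball (by linarith) hy), KobBound.of_ball hD hr hb ?_⟩
    rw [mem_ball, dist_eq_norm] at hy
    exact hy.le
  set u : Set (Cn n) := {z | ∃ c : ℝ, ∀ᶠ y in 𝓝 z, KobBound D z₀ y c} with hu
  have hsub : D ⊆ u := by
    apply hD.2.isPreconnected.subset_of_closure_inter_subset
    · rw [isOpen_iff_mem_nhds]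
      rintro z ⟨c, hc⟩
      filter_upwards [hc.eventually_nhds] with y hy
      exact ⟨c, hy⟩
    · obtain ⟨r, hr, -, h⟩ := step z₀ hz₀
      exact ⟨z₀, hz₀, _, Filter.mem_of_superset (ball_mem_nhds z₀ hr) fun y hy => (h y hy).2⟩
    · rintro z ⟨hz, hzD⟩
      obtain ⟨r, hr, -, h⟩ := step z hzD
      obtain ⟨y, ⟨c, hc⟩, hy⟩ := Metric.mem_closure_iff.1 hz r hr
      rw [dist_comm] at hy
      have hyD := (h y hy).1
      refine ⟨c + 1 / 2 * Real.log 3 + 1 / 2 * Real.log 3, ?_⟩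
      filter_upwards [ball_mem_nhds z hr] with x hx
      exact (hc.self_of_nhds.trans hD hz₀ hyD hzD ((h y hy).2.symm hD hzD hyD)).trans hD hz₀ hzD
        (h x hx).1 (h x hx).2
  exact hsub hz

theorem exists_kobBound_of_isCompact (hD : IsDom D) {z₀ : Cn n} (hz₀ : z₀ ∈ D) {K : Set (Cn n)}
    (hK : IsCompact K) (hKD : K ⊆ D) : ∃ c : ℝ, ∀ y ∈ K, KobBound D z₀ y c := by
  refine hK.induction_on (p := fun s => ∃ c : ℝ, ∀ y ∈ s, KobBound D z₀ y c) ⟨0, by simp⟩ ?_ ?_ ?_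
  · rintro s t hst ⟨c, hc⟩
    exact ⟨c, fun y hy => hc y (hst hy)⟩
  · rintro s t ⟨c, hc⟩ ⟨c', hc'⟩
    refine ⟨max c c', fun y hy => ?_⟩
    rcases hy with hy | hy
    · exact (hc y hy).mono (le_max_left _ _)
    · exact (hc' y hy).mono (le_max_right _ _)
  · intro x hx
    obtain ⟨c, hc⟩ := exists_kobBound_nhds hD hz₀ (hKD hx)
    exact ⟨_, mem_nhdsWithin_of_mem_nhds hc, c, fun y hy => hy⟩

theorem KobBound.kobayashi_le {w z : Cn n} {c : ℝ} (hc : 0 ≤ c) (h : KobBound D w z c) :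
    ((kobayashi D w z : ℝ≥0∞) : EReal) ≤ ((c : ℝ) : EReal) := by
  have h' : kobayashi D w z ≤ ENNReal.ofReal c :=
    iSup₂_le fun d hd => ENNReal.ofReal_le_ofReal (h d hd.1 hd.2)
  have h2 := EReal.coe_ennreal_le_coe_ennreal_iff.2 h'
  rwa [EReal.coe_ennreal_ofReal, max_eq_left hc] at h2

/-- A bound for the Poincaré distance of two real points. -/
theorem poincare_ofReal_le {l m : ℝ} (hl : -1 < l) (hlm : l ≤ m) (hm : m < 1) :
    poincare l m ≤ 1 / 2 * Real.log (4 / ((1 + l) * (1 - m))) := by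
  have h1 : 0 < 1 - m * l := by nlinarith
  have hn : ‖((l : ℂ) - m) / (1 - (starRingEnd ℂ) m * l)‖ = (m - l) / (1 - m * l) := by
    rw [Complex.conj_ofReal, ← Complex.ofReal_sub, ← Complex.ofReal_mul, ← Complex.ofReal_one,
      ← Complex.ofReal_sub, ← Complex.ofReal_div, Complex.norm_real, Real.norm_eq_abs, abs_div,
      abs_of_pos h1, abs_sub_comm, abs_of_nonneg (by linarith)]
  rw [poincare, hn]
  have h2 : 0 < 1 + l := by linarith
  have h3 : 0 < 1 - m := by linarith
  have h4 : (1 + (m - l) / (1 - m * l)) / (1 - (m - l) / (1 - m * l)) =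
      (1 + m) * (1 - l) / ((1 + l) * (1 - m)) := by
    have : 1 - m * l - (m - l) = (1 + l) * (1 - m) := by ring
    have h5 : 1 - (m - l) / (1 - m * l) = (1 + l) * (1 - m) / (1 - m * l) := by
      rw [← this]; field_simp
    rw [h5]
    field_simp
    ring
  rw [h4]
  gcongr
  · apply div_pos _ (by positivity)
    nlinarith
  · nlinarith

end KobReinhardt

/-! ### A maximum principle along segments in logarithmic coordinates -/

namespace KobReinhardt

open Metric Set Filter Real

variable {n : ℕ}

/-- The logarithms of the moduli of `1 + w j * l`. -/
noncomputable def logShift (w : Fin n → ℝ) (l : ℂ) : Fin n → ℝ := fun j => Real.log ‖1 + (w j : ℂ) * l‖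

/-- Taylor remainder of the logarithm: the logarithmic image of a small affine disc follows a real
segment up to a quadratic error. -/
theorem abs_log_norm_one_add_sub_re_le {z : ℂ} (hz : ‖z‖ ≤ 1 / 2) :
    |Real.log ‖1 + z‖ - z.re| ≤ ‖z‖ ^ 2 := by
  rw [← Complex.log_re, ← Complex.sub_re]
  refine (Complex.abs_re_le_norm _).trans ((Complex.norm_log_one_add_sub_self_le
    (by linarith)).trans ?_)
  have : (1 - ‖z‖)⁻¹ ≤ 2 := by
    rw [inv_le_comm₀ (by linarith) (by norm_num)]
    linarith
  nlinarith [sq_nonneg ‖z‖]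

theorem one_add_mul_mem_slitPlane {c : ℝ} (hc : |c| ≤ 1 / 2) {l : ℂ} (hl : ‖l‖ ≤ 1) :
    1 + (c : ℂ) * l ∈ Complex.slitPlane := by
  apply Complex.mem_slitPlane_of_norm_lt_one
  rw [norm_mul, Complex.norm_real, Real.norm_eq_abs]
  nlinarith [norm_nonneg l, abs_nonneg c]

theorem continuousOn_logShift {w : Fin n → ℝ} (hw : ∀ j, |w j| ≤ 1 / 2) :
    ContinuousOn (logShift w) (closedBall 0 1) := by
  refine continuousOn_pi.2 fun j => ContinuousOn.log (by fun_prop) fun l hl => ?_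
  rw [mem_closedBall_zero_iff] at hl
  exact norm_ne_zero_iff.2 (Complex.slitPlane_ne_zero (one_add_mul_mem_slitPlane (hw j) hl))

/-- The mean value inequality along the logarithmic images of affine discs. -/
def LogSubMean (V : (Fin n → ℝ) → ℝ) (L : Set (Fin n → ℝ)) : Prop :=
  ∀ x w : Fin n → ℝ, (∀ j, |w j| ≤ 1 / 2) → (∀ l : ℂ, ‖l‖ ≤ 1 → x + logShift w l ∈ L) →
    V x ≤ circleAverage (fun l => V (x + logShift w l)) 0 1

/-- Test on the disc with `w = r v`. Its image is `x + (r Re l) v + k l` with `k = O(r²)`. The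
convex term `ε (τ + r Re l)²` forces a drop of order `ε r²` in the mean of `V`; the quadratic
penalty in `k` costs only `O(r⁴)`, its linear part being harmonic with mean zero. For small `r` this
contradicts the mean value inequality. -/
theorem LogSubMean.not_touching {V : (Fin n → ℝ) → ℝ} {L : Set (Fin n → ℝ)}
    (hV : LogSubMean V L) (hL : IsOpen L) (hVc : ContinuousOn V L) {x : Fin n → ℝ} (hx : x ∈ L)
    (v y : Fin n → ℝ) (τ : ℝ) {ε K : ℝ} (hε : 0 < ε) (hK : 0 ≤ K)
    (h : ∀ᶠ p : ℝ × (Fin n → ℝ) in 𝓝 0, V (x + p.1 • v + p.2) + ε * (τ + p.1) ^ 2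
      - K * ∑ j, (y j + p.2 j) ^ 2 ≤ V x + ε * τ ^ 2 - K * ∑ j, y j ^ 2) : False := by
  obtain ⟨δ, hδ, hb⟩ := Metric.eventually_nhds_iff_ball.1 h
  obtain ⟨δ', hδ', hb'⟩ := Metric.isOpen_iff.1 hL x hx
  set B := 1 + ‖v‖ with hB
  have hB1 : 1 ≤ B := by linarith [norm_nonneg v]
  have hvB : ∀ j, |v j| ≤ B := fun j => by
    have := norm_le_pi_norm v j
    rw [Real.norm_eq_abs] at this
    linarith
  obtain ⟨r, hr0, hr⟩ : ∃ r : ℝ, 0 < r ∧ r * B < 1 / 2 ∧ 2 * r * B < δ ∧ 2 * r * B < δ' ∧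
      2 * (K * n * B ^ 4) * r ^ 2 < ε := by
    have h1 : ∀ᶠ r : ℝ in 𝓝[>] 0, r * B < 1 / 2 ∧ 2 * r * B < δ ∧ 2 * r * B < δ' ∧
        2 * (K * n * B ^ 4) * r ^ 2 < ε := by
      refine (Eventually.and ?_ (Eventually.and ?_ (Eventually.and ?_ ?_))) <;>
      · refine nhdsWithin_le_nhds (ContinuousAt.eventually_lt (by fun_prop) continuousAt_const ?_)
        simp [hδ, hδ', hε]
    obtain ⟨r, hr, hr0⟩ := (h1.and self_mem_nhdsWithin).exists
    exact ⟨r, hr0, hr⟩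
  obtain ⟨hr1, hr2, hr3, hr4⟩ := hr
  set w : Fin n → ℝ := fun j => r * v j with hw
  have hwB : ∀ j, |w j| ≤ r * B := fun j => by
    rw [hw, abs_mul, abs_of_pos hr0]
    exact mul_le_mul_of_nonneg_left (hvB j) hr0.le
  have hw2 : ∀ j, |w j| ≤ 1 / 2 := fun j => (hwB j).trans hr1.le
  -- the second order part of `logShift w l`
  set k : ℂ → Fin n → ℝ := fun l j => logShift w l j - r * l.re * v j with hk
  have hkb : ∀ l : ℂ, ‖l‖ ≤ 1 → ∀ j, |k l j| ≤ (r * B) ^ 2 := by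
    intro l hl j
    have h1 : ‖(w j : ℂ) * l‖ ≤ |w j| := by
      rw [norm_mul, Complex.norm_real, Real.norm_eq_abs]
      exact mul_le_of_le_one_right (abs_nonneg _) hl
    have h2 := abs_log_norm_one_add_sub_re_le (h1.trans (hw2 j))
    have h3 : ((w j : ℂ) * l).re = r * l.re * v j := by
      rw [Complex.re_ofReal_mul, hw]; ring
    rw [h3] at h2
    exact h2.trans (pow_le_pow_left₀ (norm_nonneg _) (h1.trans (hwB j)) 2)
  have hdec : ∀ l : ℂ, x + logShift w l = x + (r * l.re) • v + k l := by
    intro l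
    ext j
    simp [hk]
  have hkn : ∀ l : ℂ, ‖l‖ ≤ 1 → ‖k l‖ ≤ (r * B) ^ 2 := fun l hl =>
    (pi_norm_le_iff_of_nonneg (by positivity)).2 (hkb l hl)
  have hrB : (r * B) ^ 2 ≤ r * B := by nlinarith [mul_pos hr0 (by linarith : (0 : ℝ) < B)]
  have hrel : ∀ l : ℂ, ‖l‖ ≤ 1 → |r * l.re| ≤ r := fun l hl => by
    rw [abs_mul, abs_of_pos hr0]
    exact mul_le_of_le_one_right hr0.le ((Complex.abs_re_le_norm l).trans hl)
  have hmem : ∀ l : ℂ, ‖l‖ ≤ 1 → x + logShift w l ∈ L := by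
    intro l hl
    apply hb'
    rw [mem_ball, dist_eq_norm, hdec, add_assoc, add_sub_cancel_left]
    refine (norm_add_le _ _).trans_lt ?_
    rw [norm_smul, Real.norm_eq_abs]
    have h1 : |r * l.re| * ‖v‖ ≤ r * ‖v‖ := mul_le_mul_of_nonneg_right (hrel l hl) (norm_nonneg v)
    have h2 := hkn l hl
    nlinarith
  have hV1 := hV x w hw2 hmem
  -- On the unit circle `Re G` majorizes `V` along the disc: there `(Re l)² = (1 + Re l²) / 2`, and
  -- `k l j` is the real part of `log (1 + w j l) - w j l`. All nonconstant terms vanish at `0`.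
  set G : ℂ → ℂ := fun l => ((V x - ε * r ^ 2 / 2 + K * n * (r * B) ^ 4 : ℝ) : ℂ)
    + (-2 * ε * τ * r : ℝ) * l - (ε * r ^ 2 / 2 : ℝ) * l ^ 2
    + (2 * K : ℝ) * ∑ j, (y j : ℂ) * (Complex.log (1 + (w j : ℂ) * l) - (w j : ℂ) * l) with hG
  have hGa : AnalyticOnNhd ℂ G (closedBall 0 1) := by
    intro l hl
    rw [mem_closedBall_zero_iff] at hl
    have hlog : ∀ j, AnalyticAt ℂ (fun l => Complex.log (1 + (w j : ℂ) * l)) l := fun j =>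
      AnalyticAt.clog (by fun_prop) (one_add_mul_mem_slitPlane (hw2 j) hl)
    have hsum : AnalyticAt ℂ (fun l => ∑ j, (y j : ℂ) *
        (Complex.log (1 + (w j : ℂ) * l) - (w j : ℂ) * l)) l :=
      Finset.analyticAt_fun_sum _ fun j _ => by
        have := hlog j
        fun_prop
    rw [hG]
    fun_prop
  have hGre : circleAverage (fun l => (G l).re) 0 1 = (G 0).re := by
    refine InnerProductSpace.HarmonicOnNhd.circleAverage_eq fun l hl => ?_
    rw [abs_one] at hl
    exact (hGa l hl).harmonicAt_re
  have hG0 : (G 0).re = V x - ε * r ^ 2 / 2 + K * n * (r * B) ^ 4 := by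
    simp only [hG, mul_zero, add_zero, Complex.log_one, sub_zero, Finset.sum_const_zero]
    simp [-Complex.ofReal_add, -Complex.ofReal_sub, -Complex.ofReal_mul]
  have hle : circleAverage (fun l => V (x + logShift w l)) 0 1 ≤
      circleAverage (fun l => (G l).re) 0 1 := by
    apply circleAverage_mono
    · refine ContinuousOn.circleIntegrable zero_le_one ?_
      refine hVc.comp (continuousOn_const.add ((continuousOn_logShift hw2).mono
        sphere_subset_closedBall)) fun l hl => hmem l ?_
      exact mem_closedBall_zero_iff.1 (sphere_subset_closedBall hl)
    · refine ContinuousOn.circleIntegrable zero_le_one ?_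
      exact Complex.continuous_re.comp_continuousOn
        (hGa.continuousOn.mono sphere_subset_closedBall)
    · intro l hl
      rw [abs_one, mem_sphere_zero_iff_norm] at hl
      have h1 := hb (r * l.re, k l) (by
        rw [mem_ball_zero_iff, Prod.norm_def, max_lt_iff, Real.norm_eq_abs]
        have := hrel l hl.le
        have := hkn l hl.le
        constructor <;> nlinarith)
      simp only [← hdec] at h1
      have h2 : (l ^ 2).re = 2 * l.re ^ 2 - 1 := by
        have h3 : ‖l‖ ^ 2 = l.re ^ 2 + l.im ^ 2 := by
          rw [Complex.sq_norm, Complex.normSq_apply]; ring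
        rw [hl] at h3
        rw [sq, Complex.mul_re]
        linarith
      have h4 : ∀ j, (Complex.log (1 + (w j : ℂ) * l) - (w j : ℂ) * l).re = k l j := by
        intro j
        rw [Complex.sub_re, Complex.log_re, Complex.re_ofReal_mul]
        simp only [hk, logShift, hw]
        ring
      have h5 : (G l).re = V x - ε * r ^ 2 / 2 + K * n * (r * B) ^ 4 + (-2 * ε * τ * r) * l.re
          - ε * r ^ 2 / 2 * (2 * l.re ^ 2 - 1) + 2 * K * ∑ j, y j * k l j := by
        simp only [hG, Complex.add_re, Complex.sub_re, Complex.re_ofReal_mul, Complex.re_sum, h2,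
          Complex.ofReal_re, ← h4]
      have h6 : ∑ j, k l j ^ 2 ≤ n * (r * B) ^ 4 := by
        calc ∑ j, k l j ^ 2 ≤ ∑ _j : Fin n, (r * B) ^ 4 := by
              refine Finset.sum_le_sum fun j _ => ?_
              calc k l j ^ 2 = |k l j| ^ 2 := (sq_abs _).symm
                _ ≤ ((r * B) ^ 2) ^ 2 := pow_le_pow_left₀ (abs_nonneg _) (hkb l hl.le j) 2
                _ = _ := by ring
          _ = n * (r * B) ^ 4 := by simp
      have h7 : ∑ j, (y j + k l j) ^ 2 = ∑ j, y j ^ 2 + 2 * ∑ j, y j * k l j + ∑ j, k l j ^ 2 := by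
        rw [Finset.mul_sum, ← Finset.sum_add_distrib, ← Finset.sum_add_distrib]
        exact Finset.sum_congr rfl fun j _ => by ring
      rw [h7] at h1
      rw [h5]
      have h8 := mul_le_mul_of_nonneg_left h6 hK
      nlinarith
  rw [hGre, hG0] at hle
  have h9 := hV1.trans hle
  have h10 : 2 * (K * n * B ^ 4) * r ^ 2 * r ^ 2 < ε * r ^ 2 :=
    mul_lt_mul_of_pos_right hr4 (by positivity)
  nlinarith

/-- If `V` exceeded `M` on the segment, then `V + η τ² - K |y|²` on a thin tube around it would
attain its maximum in the interior, contrary to `LogSubMean.not_touching`. -/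
theorem LogSubMean.le_of_segment {V : (Fin n → ℝ) → ℝ} {L : Set (Fin n → ℝ)}
    (hV : LogSubMean V L) (hL : IsOpen L) (hVc : ContinuousOn V L) {a v : Fin n → ℝ} {M : ℝ}
    (hseg : ∀ t ∈ Icc (0 : ℝ) 1, a + t • v ∈ L) (ha : V a ≤ M) (hb : V (a + v) ≤ M)
    {t : ℝ} (ht : t ∈ Icc (0 : ℝ) 1) : V (a + t • v) ≤ M := by
  by_contra! hcon
  -- At the ends of the tube the test function is below `M + 2η`, whereas its maximum is at least `M
  -- + 3η`.
  set η := (V (a + t • v) - M) / 3 with hη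
  have hη0 : 0 < η := by rw [hη]; linarith
  have haL : a ∈ L := by simpa using hseg 0 (by simp)
  have hbL : a + v ∈ L := by simpa using hseg 1 (by simp)
  have near : ∀ p ∈ L, V p ≤ M → ∃ δ > 0, ∀ y : Fin n → ℝ, ‖y‖ ≤ δ → V (p + y) < M + η := by
    intro p hp hpM
    have h1 : ∀ᶠ q in 𝓝 p, V q < M + η :=
      (hVc.continuousAt (hL.mem_nhds hp)).eventually_lt continuousAt_const (by linarith)
    obtain ⟨δ, hδ, h2⟩ := Metric.nhds_basis_closedBall.eventually_iff.1 h1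
    exact ⟨δ, hδ, fun y hy => h2 (by simpa [mem_closedBall, dist_eq_norm] using hy)⟩
  obtain ⟨δ₁, hδ₁, h₁⟩ := near a haL ha
  obtain ⟨δ₂, hδ₂, h₂⟩ := near (a + v) hbL hb
  have hcomp : IsCompact ((fun t : ℝ => a + t • v) '' Icc 0 1) :=
    isCompact_Icc.image (by fun_prop)
  obtain ⟨δ₃, hδ₃, h₃⟩ := hcomp.exists_cthickening_subset_open hL
    (by rintro _ ⟨s, hs, rfl⟩; exact hseg s hs)
  set δ := min δ₁ (min δ₂ δ₃) with hδ
  have hδ0 : 0 < δ := lt_min hδ₁ (lt_min hδ₂ hδ₃)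
  have hTL : ∀ s ∈ Icc (0 : ℝ) 1, ∀ y : Fin n → ℝ, ‖y‖ ≤ δ → a + s • v + y ∈ L := by
    intro s hs y hy
    apply h₃
    refine mem_cthickening_of_dist_le _ (a + s • v) _ _ (mem_image_of_mem _ hs) ?_
    rw [dist_eq_norm, add_sub_cancel_left]
    exact hy.trans ((min_le_right _ _).trans (min_le_right _ _))
  set T : Set (ℝ × (Fin n → ℝ)) := Icc 0 1 ×ˢ closedBall 0 δ with hT
  have hTc : IsCompact T := isCompact_Icc.prod (isCompact_closedBall _ _)
  have hVT : ContinuousOn (fun p : ℝ × (Fin n → ℝ) => V (a + p.1 • v + p.2)) T := by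
    refine hVc.comp (by fun_prop) fun p hp => hTL _ hp.1 _ ?_
    simpa using hp.2
  obtain ⟨S, hS⟩ := hTc.bddAbove_image hVT
  have hS' : ∀ p ∈ T, V (a + p.1 • v + p.2) ≤ S := fun p hp => hS (mem_image_of_mem _ hp)
  -- With this `K` the penalty on the lateral boundary brings the test function below `M + η`.
  set K := (|S - M| + 1) / δ ^ 2 with hK
  have hK0 : 0 ≤ K := by positivity
  have htT : ((t, 0) : ℝ × (Fin n → ℝ)) ∈ T := ⟨ht, by simpa using hδ0.le⟩
  obtain ⟨⟨τ, y⟩, hp, hmax⟩ := hTc.exists_isMaxOn (f := fun p => V (a + p.1 • v + p.2)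
    + η * p.1 ^ 2 - K * ∑ j, p.2 j ^ 2) ⟨_, htT⟩
    ((hVT.add (by fun_prop)).sub (by fun_prop))
  have hge : V (a + t • v) ≤ V (a + τ • v + y) + η * τ ^ 2 - K * ∑ j, y j ^ 2 := by
    have h5 := hmax htT
    simp only [mem_ofPred_eq, Pi.zero_apply, add_zero] at h5
    norm_num at h5
    nlinarith [mul_nonneg hη0.le (sq_nonneg t)]
  have hτ : τ ∈ Icc (0 : ℝ) 1 := hp.1
  have hy : ‖y‖ ≤ δ := by simpa using hp.2
  have hsum0 : 0 ≤ ∑ j, y j ^ 2 := Finset.sum_nonneg fun j _ => sq_nonneg _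
  have hKs := mul_nonneg hK0 hsum0
  have hτ2 : τ ^ 2 ≤ 1 := by nlinarith [hτ.1, hτ.2]
  have hητ := mul_le_mul_of_nonneg_left hτ2 hη0.le
  have hτ0 : 0 < τ := by
    refine lt_of_le_of_ne hτ.1 fun h0 => ?_
    have h6 := h₁ y (hy.trans (min_le_left _ _))
    rw [← h0] at hge
    simp only [zero_smul, add_zero] at hge
    nlinarith
  have hτ1 : τ < 1 := by
    refine lt_of_le_of_ne hτ.2 fun h0 => ?_
    have h6 := h₂ y (hy.trans ((min_le_right _ _).trans (min_le_left _ _)))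
    rw [h0] at hge
    simp only [one_smul] at hge
    nlinarith
  have hyδ : ‖y‖ < δ := by
    refine lt_of_le_of_ne hy fun h0 => ?_
    have h7 : δ ^ 2 ≤ ∑ j, y j ^ 2 := by
      by_contra! h8
      have h9 : ‖y‖ < δ := by
        rw [pi_norm_lt_iff hδ0]
        intro j
        refine lt_of_pow_lt_pow_left₀ 2 hδ0.le ?_
        rw [Real.norm_eq_abs, sq_abs]
        exact (Finset.single_le_sum (f := fun j => y j ^ 2) (fun i _ => sq_nonneg _)
          (Finset.mem_univ j)).trans_lt h8
      exact h9.ne h0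
    have h10 := mul_le_mul_of_nonneg_left h7 hK0
    have h11 : K * δ ^ 2 = |S - M| + 1 := by
      rw [hK]; field_simp
    have h12 := hS' _ hp
    simp only at h12
    have := le_abs_self (S - M)
    linarith
  refine hV.not_touching hL hVc (hTL τ hτ y hy) v y τ hη0 hK0 ?_
  have hnear : ∀ᶠ p : ℝ × (Fin n → ℝ) in 𝓝 0, (τ + p.1, y + p.2) ∈ T := by
    have hcont : ContinuousAt (fun p : ℝ × (Fin n → ℝ) => (τ + p.1, y + p.2)) 0 := by fun_prop
    refine hcont.eventually_mem (prod_mem_nhds ?_ ?_)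
    · simpa using Icc_mem_nhds hτ0 hτ1
    · simpa using closedBall_mem_nhds_of_mem (x := y) (c := 0) (by simpa using hyδ)
  filter_upwards [hnear] with p hpT
  have h13 := hmax hpT
  simp only [mem_ofPred_eq, Pi.add_apply] at h13
  have h14 : a + τ • v + y + p.1 • v + p.2 = a + (τ + p.1) • v + (y + p.2) := by
    rw [add_smul]; abel
  rw [h14]
  exact h13

end KobReinhardt

/-! ### Reinhardt symmetry and the boundary distance -/

namespace KobReinhardt

open Metric Set Filter Real

variable {n : ℕ} {D : Set (Cn n)}

theorem IsReinhardtDomain.exists_rotation (hR : IsReinhardtDomain D) {z w : Cn n}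
    (h : ∀ j, ‖z j‖ = ‖w j‖) : ∃ R : Cn n ≃ₗᵢ[ℝ] Cn n, R z = w ∧ R '' D = D := by
  have h1 : ∀ j, ∃ l : Circle, l * z j = w j := by
    intro j
    by_cases hz : z j = 0
    · refine ⟨1, ?_⟩
      have := h j
      rw [hz, norm_zero, eq_comm, norm_eq_zero] at this
      simp [hz, this]
    · have hl : ‖w j / z j‖ = 1 := by
        rw [norm_div, h j, div_self]
        rw [← h j]
        exact norm_ne_zero_iff.2 hz
      exact ⟨⟨w j / z j, mem_sphere_zero_iff_norm.2 hl⟩, div_mul_cancel₀ _ hz⟩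
  choose l hl using h1
  have hmap : ∀ l : Fin n → Circle, ∀ x ∈ D,
      LinearIsometryEquiv.piLpCongrRight 2 (fun j => rotation (l j)) x ∈ D := by
    intro l x hx
    exact hR.2 (fun j => l j) (fun j => Circle.norm_coe _) x hx
  refine ⟨LinearIsometryEquiv.piLpCongrRight 2 fun j => rotation (l j), ?_, ?_⟩
  · ext j
    simp [hl]
  · apply Subset.antisymm
    · rintro _ ⟨x, hx, rfl⟩
      exact hmap l x hx
    · intro x hx
      refine ⟨_, hmap (fun j => (l j)⁻¹) x hx, ?_⟩
      ext j
      simp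

theorem IsReinhardtDomain.mem_of_norm_eq (hR : IsReinhardtDomain D) {z w : Cn n}
    (h : ∀ j, ‖z j‖ = ‖w j‖) (hz : z ∈ D) : w ∈ D := by
  obtain ⟨R, hRz, hRD⟩ := hR.exists_rotation h
  rw [← hRz, ← hRD]
  exact mem_image_of_mem _ hz

theorem IsReinhardtDomain.bdist_eq_of_norm_eq (hR : IsReinhardtDomain D) {z w : Cn n}
    (h : ∀ j, ‖z j‖ = ‖w j‖) : bdist D z = bdist D w := by
  obtain ⟨R, hRz, hRD⟩ := hR.exists_rotation h
  have hf : R '' frontier D = frontier D := by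
    conv_rhs => rw [← hRD]
    exact R.toHomeomorph.image_frontier D
  rw [bdist, bdist, ← hRz, ← Metric.infDist_image R.isometry, hf]

theorem ball_bdist_subset {z : Cn n} (hz : z ∈ D) (hD : IsOpen D) : ball z (bdist D z) ⊆ D := by
  rcases lt_or_ge 0 (bdist D z) with h | h
  · refine (convex_ball z _).isPreconnected.subset_of_closure_inter_subset hD
      ⟨z, mem_ball_self h, hz⟩ ?_
    rintro y ⟨hy, hyb⟩
    rw [closure_eq_self_union_frontier] at hy
    refine hy.resolve_right fun hyf => ?_
    have := Metric.infDist_le_dist_of_mem (x := z) hyf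
    rw [mem_ball, dist_comm] at hyb
    exact (this.trans_lt hyb).ne rfl
  · rw [ball_eq_empty.2 h]
    exact empty_subset _

/-- The frontier must be nonempty because `infDist` to the empty set is `0`. -/
theorem bdist_pos {z : Cn n} (hz : z ∈ D) (hD : IsOpen D) (hf : (frontier D).Nonempty) :
    0 < bdist D z := by
  refine (isClosed_frontier.notMem_iff_infDist_pos hf).1 fun h => ?_
  rw [hD.frontier_eq] at h
  exact h.2 hz

/-! ### The logarithmic image and its convexity -/

/-- The coordinatewise exponential map. -/
noncomputable def expPt (a : Fin n → ℂ) : Cn n := WithLp.toLp 2 fun j => Complex.exp (a j)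

/-- The point with the coordinates `exp (x j)`. -/
noncomputable def rexpPt (x : Fin n → ℝ) : Cn n := expPt fun j => (x j : ℂ)

@[simp] theorem expPt_apply (a : Fin n → ℂ) (j : Fin n) : expPt a j = Complex.exp (a j) := rfl

@[simp] theorem norm_rexpPt_apply (x : Fin n → ℝ) (j : Fin n) :
    ‖rexpPt x j‖ = Real.exp (x j) := by
  simp [rexpPt, Complex.norm_exp]

theorem continuous_rexpPt : Continuous (rexpPt : (Fin n → ℝ) → Cn n) := by
  unfold rexpPt expPt
  fun_prop

/-- The logarithmic image of `D`. -/
def logImage (D : Set (Cn n)) : Set (Fin n → ℝ) := rexpPt ⁻¹' D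

theorem isOpen_logImage (hD : IsOpen D) : IsOpen (logImage D) := hD.preimage continuous_rexpPt

theorem IsReinhardtDomain.expPt_mem (hR : IsReinhardtDomain D) {a : Fin n → ℂ}
    (h : (fun j => (a j).re) ∈ logImage D) : expPt a ∈ D :=
  hR.mem_of_norm_eq (fun j => by
    rw [norm_rexpPt_apply, expPt_apply, Complex.norm_exp]) h

theorem continuousOn_log_bdist_rexpPt (hP : IsPseudoconvex D) :
    ContinuousOn (fun x => -Real.log (bdist D (rexpPt x))) (logImage D) :=
  hP.1.comp continuous_rexpPt.continuousOn fun _ hx => hx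

/-- By rotation invariance, `x + logShift w l` stands for the point with coordinates `exp (x j) (1 +
w j l)`, which runs over an affine disc. -/
theorem IsReinhardtDomain.logSubMean (hR : IsReinhardtDomain D) (hP : IsPseudoconvex D) :
    LogSubMean (fun x => -Real.log (bdist D (rexpPt x))) (logImage D) := by
  intro x w hw hmem
  have hnorm : ∀ l : ℂ, ‖l‖ ≤ 1 → ∀ j, ‖rexpPt (x + logShift w l) j‖ =
      ‖(rexpPt x + l • (WithLp.toLp 2 fun j => (w j : ℂ) * rexpPt x j : Cn n)) j‖ := by
    intro l hl j
    have h1 := Complex.slitPlane_ne_zero (one_add_mul_mem_slitPlane (hw j) hl)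
    have h2 : (rexpPt x + l • (WithLp.toLp 2 fun j => (w j : ℂ) * rexpPt x j : Cn n)) j =
        rexpPt x j * (1 + (w j : ℂ) * l) := by
      simp only [PiLp.add_apply, PiLp.smul_apply, smul_eq_mul]
      ring
    rw [h2, norm_mul, norm_rexpPt_apply, norm_rexpPt_apply, Pi.add_apply, Real.exp_add, logShift,
      Real.exp_log (norm_pos_iff.2 h1)]
  have h := hP.2 (rexpPt x) (WithLp.toLp 2 fun j => (w j : ℂ) * rexpPt x j)
    fun l hl => hR.mem_of_norm_eq (hnorm l hl) (hmem l hl)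
  refine h.trans_eq (circleAverage_congr_sphere fun l hl => ?_)
  rw [abs_one, mem_sphere_zero_iff_norm] at hl
  simp only [hR.bdist_eq_of_norm_eq (hnorm l hl.le)]

/-- Raising the moduli of the coordinates to at least `δ`. -/
noncomputable def raise (δ : ℝ) (z : Cn n) : Fin n → ℝ := fun j => Real.log (max ‖z j‖ δ)

theorem continuous_raise {δ : ℝ} (hδ : 0 < δ) : Continuous (raise δ : Cn n → Fin n → ℝ) := by
  unfold raise
  refine continuous_pi fun j => Continuous.log (by fun_prop) fun z => ?_
  exact (lt_max_of_lt_right hδ).ne'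

theorem norm_le_sum_norm (z : Cn n) : ‖z‖ ≤ ∑ j, ‖z j‖ := by
  rw [EuclideanSpace.norm_eq]
  refine Real.sqrt_le_iff.2 ⟨Finset.sum_nonneg fun j _ => norm_nonneg _, ?_⟩
  exact Finset.sum_sq_le_sq_sum_of_nonneg fun j _ => norm_nonneg _

theorem norm_le_card_mul {z : Cn n} {c : ℝ} (h : ∀ j, ‖z j‖ ≤ c) : ‖z‖ ≤ n * c :=
  (norm_le_sum_norm z).trans ((Finset.sum_le_sum fun j _ => h j).trans (by simp))

theorem IsReinhardtDomain.raise_mem (hR : IsReinhardtDomain D) {δ ρ : ℝ} (hδ : 0 < δ)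
    (hδρ : n * δ < ρ) {z : Cn n} (hz : z ∈ D) (hρ : ρ ≤ bdist D z) : raise δ z ∈ logImage D := by
  set z' : Cn n := WithLp.toLp 2 fun j => (‖z j‖ : ℂ) with hz'
  have hnorm : ∀ j, ‖z j‖ = ‖z' j‖ := fun j => by simp [hz']
  have hz'D := hR.mem_of_norm_eq hnorm hz
  apply ball_bdist_subset hz'D hR.1.1
  rw [← hR.bdist_eq_of_norm_eq hnorm, mem_ball, dist_eq_norm]
  refine lt_of_le_of_lt (norm_le_card_mul (c := δ) fun j => ?_) (hδρ.trans_le hρ)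
  have h1 : (rexpPt (raise δ z) - z') j = ((max ‖z j‖ δ - ‖z j‖ : ℝ) : ℂ) := by
    simp only [PiLp.sub_apply, hz', rexpPt, expPt_apply, raise]
    rw [← Complex.ofReal_exp, Real.exp_log (lt_max_of_lt_right hδ)]
    simp
  rw [h1, Complex.norm_real, Real.norm_eq_abs, abs_of_nonneg (by linarith [le_max_left ‖z j‖ δ])]
  rcases max_cases ‖z j‖ δ with h | h <;> linarith [norm_nonneg (z j)]

theorem continuous_bdist : Continuous (bdist D) := Metric.continuous_infDist_pt _

/-- A path in `D` may meet the coordinate hyperplanes. It keeps a positive distance from the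
boundary, so raising small moduli to a tiny `δ` keeps it in `D`; its endpoints do not change if `δ`
is below their moduli. -/
theorem IsReinhardtDomain.isPreconnected_logImage (hR : IsReinhardtDomain D)
    (hf : (frontier D).Nonempty) : IsPreconnected (logImage D) := by
  rcases (logImage D).eq_empty_or_nonempty with he | hne
  · rw [he]; exact isPreconnected_empty
  refine IsPathConnected.isConnected ?_ |>.isPreconnected
  refine isPathConnected_iff.2 ⟨hne, fun x hx y hy => ?_⟩
  have hpc := hR.1.1.isConnected_iff_isPathConnected.1 hR.1.2
  obtain ⟨γ, hγ⟩ := hpc.joinedIn (rexpPt x) hx (rexpPt y) hy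
  obtain ⟨t₀, -, ht₀⟩ := isCompact_univ.exists_isMinOn (f := fun t => bdist D (γ t))
    ⟨0, mem_univ _⟩ (continuous_bdist.comp γ.continuous).continuousOn
  have hpos := bdist_pos (hγ t₀) hR.1.1 hf
  obtain ⟨δ, hδ, hδ1, hδx, hδy⟩ : ∃ δ : ℝ, 0 < δ ∧ n * δ < bdist D (γ t₀) ∧
      (∀ j, δ < Real.exp (x j)) ∧ (∀ j, δ < Real.exp (y j)) := by
    have h1 : ∀ᶠ δ : ℝ in 𝓝[>] 0, n * δ < bdist D (γ t₀) ∧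
        (∀ j, δ < Real.exp (x j)) ∧ (∀ j, δ < Real.exp (y j)) := by
      refine (Eventually.and ?_ (Eventually.and (eventually_all.2 fun j => ?_)
        (eventually_all.2 fun j => ?_))) <;>
      · refine nhdsWithin_le_nhds (ContinuousAt.eventually_lt (by fun_prop) continuousAt_const ?_)
        simp [hpos, Real.exp_pos]
    obtain ⟨δ, h, h0⟩ := (h1.and self_mem_nhdsWithin).exists
    exact ⟨δ, h0, h⟩
  have hend : ∀ x : Fin n → ℝ, (∀ j, δ < Real.exp (x j)) → raise δ (rexpPt x) = x := by
    intro x hx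
    ext j
    rw [raise, norm_rexpPt_apply, max_eq_left (hx j).le, Real.log_exp]
  refine ⟨(γ.map (continuous_raise hδ)).cast (hend x hδx).symm (hend y hδy).symm, fun t => ?_⟩
  exact hR.raise_mem hδ hδ1 (hγ t) (ht₀ (mem_univ t))

/-- The `y` whose segment to `x` lies in `logImage D` form an open set. It is also relatively
closed: the maximum principle bounds `d_D` from below on the segments to nearby `q`, so the limit
segment stays in `D`. -/
theorem IsReinhardtDomain.segment_subset (hR : IsReinhardtDomain D) (hP : IsPseudoconvex D)
    (hf : (frontier D).Nonempty) {x y : Fin n → ℝ} (hx : x ∈ logImage D) (hy : y ∈ logImage D) :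
    ∀ t ∈ Icc (0 : ℝ) 1, x + t • (y - x) ∈ logImage D := by
  have hLo := isOpen_logImage hR.1.1
  set u : Set (Fin n → ℝ) := {y | ∀ t ∈ Icc (0 : ℝ) 1, x + t • (y - x) ∈ logImage D} with hu
  suffices h : logImage D ⊆ u from h hy
  apply (hR.isPreconnected_logImage hf).subset_of_closure_inter_subset
  · rw [isOpen_iff_eventually]
    intro y hy
    refine isCompact_Icc.eventually_forall_of_forall_eventually fun t ht => ?_
    have hc : Continuous fun p : (Fin n → ℝ) × ℝ => x + p.2 • (p.1 - x) := by fun_prop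
    exact hc.continuousAt.eventually_mem (hLo.mem_nhds (hy t ht))
  · refine ⟨x, hx, fun t _ => by simpa using hx⟩
  · rintro y ⟨hyc, hyL⟩ t ht
    set V : (Fin n → ℝ) → ℝ := fun x => -Real.log (bdist D (rexpPt x)) with hV
    have hVc := continuousOn_log_bdist_rexpPt hP
    -- `M` must not depend on `q`; the margin `1` absorbs the variation of `V` near `y`.
    set M := max (V x) (V y + 1) with hM
    have h1 : ∀ᶠ q in 𝓝 y, V q < V y + 1 :=
      (hVc.continuousAt (hLo.mem_nhds hyL)).eventually_lt continuousAt_const (by linarith)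
    have hc : Continuous fun q : Fin n → ℝ => rexpPt (x + t • (q - x)) := by
      have := continuous_rexpPt (n := n)
      fun_prop
    have h2 : ∀ᶠ q in 𝓝 y, rexpPt (x + t • (q - x)) ∈
        ball (rexpPt (x + t • (y - x))) (Real.exp (-M)) :=
      hc.continuousAt.eventually_mem (ball_mem_nhds _ (Real.exp_pos _))
    obtain ⟨q, hqu, hq1, hq2⟩ := ((mem_closure_iff_frequently.1 hyc).and_eventually
      (h1.and h2)).exists
    have hqt : V (x + t • (q - x)) ≤ M := by
      refine (hR.logSubMean hP).le_of_segment hLo hVc hqu (le_max_left _ _) ?_ ht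
      rw [add_sub_cancel]
      exact hq1.le.trans (le_max_right _ _)
    have hpos : 0 < bdist D (rexpPt (x + t • (q - x))) := bdist_pos (hqu t ht) hR.1.1 hf
    have hle : Real.exp (-M) ≤ bdist D (rexpPt (x + t • (q - x))) := by
      rw [← Real.le_log_iff_exp_le hpos]
      simp only [hV] at hqt
      linarith
    refine ball_bdist_subset (hqu t ht) hR.1.1 ?_
    rw [mem_ball, dist_comm]
    exact (mem_ball.1 hq2).trans_le hle

end KobReinhardt

/-! ### Exponential discs over prolonged segments -/

namespace KobReinhardt

open Metric Set Filter Real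

variable {n : ℕ} {D : Set (Cn n)}

theorem IsReinhardtDomain.kobBound_expPt (hR : IsReinhardtDomain D) (hP : IsPseudoconvex D)
    (hf : (frontier D).Nonempty) {x₀ x : Fin n → ℝ} {r s : ℝ} (hr : 0 < r) (hr1 : r ≤ 1)
    (hs : 0 < s) (hs1 : s ≤ 1) (h₀ : x₀ - r • (x - x₀) ∈ logImage D)
    (h₁ : x + s • (x - x₀) ∈ logImage D) (θ : Fin n → ℝ) :
    KobBound D (expPt fun j => (x₀ j : ℂ) + θ j * Complex.I)
      (expPt fun j => (x j : ℂ) + θ j * Complex.I) (1 / 2 * Real.log (9 / (r * s))) := by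
  -- `l ↦ c + ρ l` maps the unit disc onto the disc with real diameter `(-r, 1 + s)`; the parameters
  -- `0` and `1` correspond to `x₀` and `x`.
  set c : ℝ := (1 + s - r) / 2 with hc
  set ρ : ℝ := (1 + r + s) / 2 with hρ
  have hρ0 : 0 < ρ := by positivity
  have hρ0' : (ρ : ℂ) ≠ 0 := by exact_mod_cast hρ0.ne'
  set f : ℂ → Cn n := fun l => expPt fun j =>
    (x₀ j : ℂ) + ((c : ℂ) + ρ * l) * ((x j - x₀ j : ℝ) : ℂ) + θ j * Complex.I with hfdef
  have hfd : DifferentiableOn ℂ f (ball 0 1) := by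
    refine Differentiable.differentiableOn ?_
    rw [hfdef]
    unfold expPt
    rw [differentiable_euclidean]
    intro j
    simp only
    fun_prop
  have hfD : MapsTo f (ball 0 1) D := by
    intro l hl
    rw [mem_ball_zero_iff] at hl
    apply hR.expPt_mem
    have hre := (abs_lt.1 ((Complex.abs_re_le_norm l).trans_lt hl))
    convert hR.segment_subset hP hf h₀ h₁ ((1 + l.re) / 2)
      ⟨by linarith [hre.1], by linarith [hre.2]⟩ using 1
    ext j
    simp
    simp only [hc, hρ]
    ring
  have hl : ((-(c / ρ) : ℝ) : ℂ) ∈ ball (0 : ℂ) 1 := by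
    rw [mem_ball_zero_iff, Complex.norm_real, Real.norm_eq_abs, abs_neg, abs_div, abs_of_pos hρ0,
      div_lt_one hρ0, abs_lt]
    constructor <;> linarith
  have hm : (((1 - c) / ρ : ℝ) : ℂ) ∈ ball (0 : ℂ) 1 := by
    rw [mem_ball_zero_iff, Complex.norm_real, Real.norm_eq_abs, abs_div, abs_of_pos hρ0,
      div_lt_one hρ0, abs_lt]
    constructor <;> linarith
  have hl1 : 1 + -(c / ρ) = r / ρ := by
    field_simp
    linarith
  have hm1 : 1 - (1 - c) / ρ = s / ρ := by
    field_simp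
    linarith
  have hdist : poincare ((-(c / ρ) : ℝ) : ℂ) (((1 - c) / ρ : ℝ) : ℂ) ≤
      1 / 2 * Real.log (9 / (r * s)) := by
    have h1 : 0 < r / ρ := by positivity
    have h2 : 0 < s / ρ := by positivity
    refine (poincare_ofReal_le (by linarith) ?_ (by linarith)).trans ?_
    · rw [← sub_nonneg]
      have : (1 - c) / ρ - -(c / ρ) = 1 / ρ := by field_simp; ring
      rw [this]
      positivity
    · rw [hl1, hm1]
      -- The constant `9` comes from `2 ρ = 1 + r + s ≤ 3`.
      have : 4 / (r / ρ * (s / ρ)) = 4 * ρ ^ 2 / (r * s) := by field_simp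
      rw [this]
      gcongr
      nlinarith
  have hnn : 0 ≤ 1 / 2 * Real.log (9 / (r * s)) := by
    have : 1 ≤ 9 / (r * s) := by
      rw [le_div_iff₀ (by positivity)]
      nlinarith
    have := Real.log_nonneg this
    positivity
  have key := KobBound.of_disc hR.1 hfd hfD hl hm hnn hdist
  have hfl : f ((-(c / ρ) : ℝ) : ℂ) = expPt fun j => (x₀ j : ℂ) + θ j * Complex.I := by
    simp only [hfdef]
    congr 1
    ext j
    push_cast
    field_simp
    ring
  have hfm : f (((1 - c) / ρ : ℝ) : ℂ) = expPt fun j => (x j : ℂ) + θ j * Complex.I := by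
    simp only [hfdef]
    congr 1
    ext j
    push_cast
    field_simp
    ring
  rwa [hfl, hfm] at key

/-- The displacement is linear in `s`, uniformly as `x → -∞`, that is, as a coordinate tends to `0`:
the factor `exp x` then absorbs `y - x`. -/
theorem abs_exp_add_mul_sub_exp_le {x y s R : ℝ} (hs : 0 ≤ s) (hs1 : s ≤ 1)
    (hx : Real.exp x ≤ R) : |Real.exp (x + s * (x - y)) - Real.exp x| ≤
      s * (Real.exp y + R ^ 3 / Real.exp y ^ 2) := by
  have hR : 0 < R := (Real.exp_pos x).trans_le hx
  have hR3 : 0 ≤ R ^ 3 / Real.exp y ^ 2 := by positivity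
  have h0 : Real.exp (x + s * (x - y)) - Real.exp x =
      Real.exp x * (Real.exp (s * (x - y)) - 1) := by
    rw [Real.exp_add]; ring
  rw [h0, abs_mul, abs_of_pos (Real.exp_pos x)]
  rcases le_total 0 (x - y) with hv | hv
  · have hsv : 0 ≤ s * (x - y) := mul_nonneg hs hv
    have h1 : 1 ≤ Real.exp (s * (x - y)) := Real.one_le_exp hsv
    have h2 : Real.exp (s * (x - y)) - 1 ≤ s * (x - y) * Real.exp (s * (x - y)) := by
      have h3 := Real.add_one_le_exp (-(s * (x - y)))
      have h4 : Real.exp (-(s * (x - y))) * Real.exp (s * (x - y)) = 1 := by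
        rw [← Real.exp_add]; simp
      nlinarith [Real.exp_pos (s * (x - y))]
    have h5 : Real.exp (s * (x - y)) ≤ Real.exp (x - y) := Real.exp_le_exp.2 (by nlinarith)
    have h6 : x - y ≤ Real.exp (x - y) := by linarith [Real.add_one_le_exp (x - y)]
    rw [abs_of_nonneg (by linarith)]
    have h7 : Real.exp x * (Real.exp (x - y) * Real.exp (x - y)) =
        Real.exp x ^ 3 / Real.exp y ^ 2 := by
      rw [Real.exp_sub]; field_simp
    have h8 : Real.exp x ^ 3 / Real.exp y ^ 2 ≤ R ^ 3 / Real.exp y ^ 2 := by gcongr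
    calc Real.exp x * (Real.exp (s * (x - y)) - 1)
        ≤ Real.exp x * (s * (x - y) * Real.exp (s * (x - y))) := by gcongr
      _ ≤ Real.exp x * (s * Real.exp (x - y) * Real.exp (x - y)) := by gcongr
      _ = s * (Real.exp x * (Real.exp (x - y) * Real.exp (x - y))) := by ring
      _ ≤ s * (Real.exp y + R ^ 3 / Real.exp y ^ 2) := by
        rw [h7]
        gcongr
        linarith [Real.exp_pos y]
  · have hsv : s * (x - y) ≤ 0 := mul_nonpos_of_nonneg_of_nonpos hs hv
    have h1 : Real.exp (s * (x - y)) ≤ 1 := Real.exp_le_one_iff.2 hsv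
    rw [abs_of_nonpos (by linarith)]
    have h2 := Real.add_one_le_exp (s * (x - y))
    have h3 := Real.add_one_le_exp (y - x)
    have h4 : Real.exp x * Real.exp (y - x) = Real.exp y := by
      rw [← Real.exp_add]; simp
    calc Real.exp x * -(Real.exp (s * (x - y)) - 1)
        ≤ Real.exp x * (s * Real.exp (y - x)) := by
          gcongr
          nlinarith
      _ = s * (Real.exp x * Real.exp (y - x)) := by ring
      _ ≤ s * (Real.exp y + R ^ 3 / Real.exp y ^ 2) := by
        rw [h4]
        gcongr
        linarith

/-- Apply `IsReinhardtDomain.kobBound_expPt` with `r = ρ / B` and `s = d_D(z) / (M + 1)`, using the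
arguments of `z` as `θ`. The constant `C` does not depend on `z` or `B`. -/
theorem IsReinhardtDomain.exists_kobBound (hR : IsReinhardtDomain D) (hP : IsPseudoconvex D)
    (hf : (frontier D).Nonempty) {z₀ : Cn n} (hz₀ : z₀ ∈ D) {x₀ : Fin n → ℝ}
    (hx₀ : x₀ ∈ logImage D) (R : ℝ) :
    ∃ C : ℝ, ∀ z ∈ D, (∀ j, z j ≠ 0) → ‖z‖ ≤ R → bdist D z ≤ 1 → ∀ B : ℝ, 1 ≤ B →
      ‖(fun j => Real.log ‖z j‖) - x₀‖ ≤ B →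
      KobBound D z₀ z (-(1 / 2) * Real.log (bdist D z) + 1 / 2 * Real.log B + C) := by
  set e : (Fin n → ℝ) → Cn n := fun θ => expPt fun j => (x₀ j : ℂ) + θ j * Complex.I with he
  have heD : ∀ θ, e θ ∈ D := fun θ => hR.expPt_mem (by simpa using hx₀)
  have hec : Continuous e := by
    rw [he]
    unfold expPt
    fun_prop
  obtain ⟨C₀, hC₀⟩ := exists_kobBound_of_isCompact hR.1 hz₀
    ((isCompact_univ_pi fun _ => isCompact_Icc (a := -π) (b := π)).image hec)
    (by rintro _ ⟨θ, -, rfl⟩; exact heD θ)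
  obtain ⟨ρ₁, hρ₁, hball⟩ := Metric.isOpen_iff.1 (isOpen_logImage hR.1.1) x₀ hx₀
  set ρ := min (ρ₁ / 2) 1 with hρ
  have hρ0 : 0 < ρ := by positivity
  have hρ1 : ρ ≤ 1 := min_le_right _ _
  have hρρ : ρ < ρ₁ := (min_le_left _ _).trans_lt (by linarith)
  set M := ∑ j, (Real.exp (x₀ j) + |R| ^ 3 / Real.exp (x₀ j) ^ 2) with hM
  have hM0 : 0 ≤ M := Finset.sum_nonneg fun j _ => by positivity
  refine ⟨1 / 2 * Real.log (9 * (M + 1) / ρ) + C₀, fun z hz hz0 hzR hz1 B hB hzB => ?_⟩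
  set x : Fin n → ℝ := fun j => Real.log ‖z j‖ with hx
  have hexp : ∀ j, Real.exp (x j) = ‖z j‖ := fun j => Real.exp_log (norm_pos_iff.2 (hz0 j))
  have hd := bdist_pos hz hR.1.1 hf
  have hB0 : 0 < B := by linarith
  set s := bdist D z / (M + 1) with hs
  have hs0 : 0 < s := by positivity
  have hs1 : s ≤ 1 := (div_le_one (by positivity)).2 (by linarith)
  have hsM : s * M < bdist D z := by
    rw [hs, div_mul_eq_mul_div, div_lt_iff₀ (by positivity)]
    nlinarith
  have hrmem : x₀ - (ρ / B) • (x - x₀) ∈ logImage D := by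
    apply hball
    rw [mem_ball, dist_eq_norm, sub_sub_cancel_left, norm_neg, norm_smul, Real.norm_eq_abs,
      abs_of_pos (by positivity)]
    calc ρ / B * ‖x - x₀‖ ≤ ρ / B * B := by gcongr
      _ = ρ := by field_simp
      _ < ρ₁ := hρρ
  have hnorm : ∀ j, ‖z j‖ = ‖rexpPt x j‖ := fun j => by rw [norm_rexpPt_apply, hexp]
  have hsmem : x + s • (x - x₀) ∈ logImage D := by
    apply ball_bdist_subset (hR.mem_of_norm_eq hnorm hz) hR.1.1
    rw [← hR.bdist_eq_of_norm_eq hnorm, mem_ball, dist_eq_norm]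
    refine (norm_le_sum_norm _).trans_lt (lt_of_le_of_lt ?_ hsM)
    rw [hM, Finset.mul_sum]
    refine Finset.sum_le_sum fun j _ => ?_
    have h1 : (rexpPt (x + s • (x - x₀)) - rexpPt x) j =
        ((Real.exp (x j + s * (x j - x₀ j)) - Real.exp (x j) : ℝ) : ℂ) := by
      simp [rexpPt]
    rw [h1, Complex.norm_real, Real.norm_eq_abs]
    refine abs_exp_add_mul_sub_exp_le hs0.le hs1 ?_
    rw [hexp]
    exact (PiLp.norm_apply_le z j).trans (hzR.trans (le_abs_self R))
  have hdisc := hR.kobBound_expPt hP hf (x₀ := x₀) (x := x) (r := ρ / B) (by positivity)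
    ((div_le_one hB0).2 (hρ1.trans hB)) hs0 hs1 hrmem hsmem fun j => Complex.arg (z j)
  have hzeq : (expPt fun j => (x j : ℂ) + (Complex.arg (z j) : ℂ) * Complex.I) = z := by
    ext j
    rw [expPt_apply]
    exact Complex.exp_log (hz0 j)
  rw [hzeq] at hdisc
  have h₀ := hC₀ (e fun j => Complex.arg (z j)) (mem_image_of_mem _ fun j _ =>
    ⟨(Complex.neg_pi_lt_arg _).le, Complex.arg_le_pi _⟩)
  refine (h₀.trans hR.1 hz₀ (heD _) hz hdisc).mono (le_of_eq ?_)
  have h2 : 9 / (ρ / B * s) = (bdist D z)⁻¹ * B * (9 * (M + 1) / ρ) := by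
    rw [hs]
    simp only [div_eq_mul_inv, mul_inv, inv_inv]
    ring
  have h3 : 0 < 9 * (M + 1) / ρ := div_pos (by linarith) hρ0
  rw [h2, Real.log_mul (mul_pos (inv_pos.2 hd) hB0).ne' h3.ne',
    Real.log_mul (inv_pos.2 hd).ne' hB0.ne', Real.log_inv]
  ring

theorem IsReinhardtDomain.exists_mem_logImage (hR : IsReinhardtDomain D)
    (hf : (frontier D).Nonempty) {z₀ : Cn n} (hz₀ : z₀ ∈ D) : (logImage D).Nonempty := by
  have hd := bdist_pos hz₀ hR.1.1 hf
  refine ⟨_, hR.raise_mem (δ := bdist D z₀ / (n + 1)) (by positivity) ?_ hz₀ le_rfl⟩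
  rw [← mul_div_assoc, div_lt_iff₀ (by positivity)]
  nlinarith

theorem bdist_le_norm_sub {ζ : Cn n} (hζ : ζ ∈ frontier D) (z : Cn n) : bdist D z ≤ ‖z - ζ‖ := by
  rw [← dist_eq_norm]
  exact Metric.infDist_le_dist_of_mem hζ

/-- Every point has a neighbour, within half of its distance to the boundary, none of whose
coordinates is small. -/
theorem exists_near_coord_ge (z : Cn n) {d : ℝ} (hd : 0 < d) :
    ∃ z' : Cn n, ‖z' - z‖ ≤ d / 2 ∧ ∀ j, d / (4 * (n + 1)) ≤ ‖z' j‖ := by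
  -- Each coordinate moves by at most `2 δ`, and `2 n δ ≤ d / 2`.
  set δ := d / (4 * (n + 1)) with hδ
  have hδ0 : 0 < δ := by positivity
  refine ⟨WithLp.toLp 2 fun j => if δ ≤ ‖z j‖ then z j else (δ : ℂ), ?_, fun j => ?_⟩
  · refine (norm_le_card_mul (c := 2 * δ) fun j => ?_).trans ?_
    · simp only [PiLp.sub_apply]
      split_ifs with h
      · simp [hδ0.le]
      · refine (norm_sub_le _ _).trans ?_
        rw [Complex.norm_real, Real.norm_eq_abs, abs_of_pos hδ0]
        linarith
    · have h1 : δ * (4 * (n + 1)) = d := by rw [hδ]; field_simp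
      nlinarith
  · simp only
    split_ifs with h
    · exact h
    · rw [Complex.norm_real, Real.norm_eq_abs, abs_of_pos hδ0]

end KobReinhardt

/-! ### The two boundary estimates -/

open KobReinhardt in
theorem KobReinhardt.kobayashi_le_neg_log {n : ℕ} {D : Set (Cn n)}
    (hR : IsReinhardtDomain D) (hP : IsPseudoconvex D) {z₀ : Cn n} (hz₀ : z₀ ∈ D) {ζ₀ : Cn n}
    (hζ₀ : ζ₀ ∈ frontier D) : ∃ C : ℝ, ∀ᶠ z in 𝓝[D] ζ₀,
      ((kobayashi D z₀ z : ℝ≥0∞) : EReal) ≤ ((-Real.log (bdist D z) + C : ℝ) : EReal) := by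
  have hf : (frontier D).Nonempty := ⟨ζ₀, hζ₀⟩
  obtain ⟨x₀, hx₀⟩ := hR.exists_mem_logImage hf hz₀
  set R := ‖ζ₀‖ + 1 with hRdef
  have hR1 : 1 ≤ R := by linarith [norm_nonneg ζ₀]
  obtain ⟨C, hC⟩ := hR.exists_kobBound hP hf hz₀ hx₀ R
  set A := Real.log R + 4 * (n + 1) + ‖x₀‖ with hA
  have hlogR : 0 ≤ Real.log R := Real.log_nonneg hR1
  have hA1 : 1 ≤ A := by
    have := norm_nonneg x₀
    have : (0 : ℝ) ≤ n := n.cast_nonneg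
    linarith
  set C' := 1 / 2 * Real.log 2 + 1 / 2 * Real.log A + C + 1 / 2 * Real.log 3 with hC'
  -- The maximum with `0` keeps the bound nonnegative, as `KobBound.kobayashi_le` requires.
  refine ⟨max C' 0, ?_⟩
  filter_upwards [self_mem_nhdsWithin, mem_nhdsWithin_of_mem_nhds
    (Metric.closedBall_mem_nhds ζ₀ (by norm_num : (0 : ℝ) < 1 / 2))] with z hz hzζ
  rw [Metric.mem_closedBall, dist_eq_norm] at hzζ
  have hd := bdist_pos hz hR.1.1 hf
  have hd1 := (bdist_le_norm_sub hζ₀ z).trans hzζ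
  obtain ⟨z', hzz', hz'⟩ := exists_near_coord_ge z hd
  set d := bdist D z with hddef
  set δ := d / (4 * ((n : ℝ) + 1)) with hδ
  have hδ0 : 0 < δ := by positivity
  have hball := ball_bdist_subset hz hR.1.1
  have hz'D : z' ∈ D := hball (by rw [Metric.mem_ball, dist_eq_norm]; linarith)
  have hz'ζ : ‖z' - ζ₀‖ ≤ 1 := by
    have := norm_add_le (z' - z) (z - ζ₀)
    rw [sub_add_sub_cancel] at this
    linarith
  have hz'R : ‖z'‖ ≤ R := by
    have := norm_add_le (z' - ζ₀) ζ₀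
    rw [sub_add_cancel] at this
    linarith
  have hz'0 : ∀ j, 0 < ‖z' j‖ := fun j => hδ0.trans_le (hz' j)
  have hd' : d / 2 ≤ bdist D z' := by
    have : d ≤ bdist D z' + dist z z' := Metric.infDist_le_infDist_add_dist
    rw [dist_comm, dist_eq_norm] at this
    linarith
  have hAd : 1 ≤ A / d := (one_le_div hd).2 (by linarith)
  -- The crude inequality `log δ ≥ 1 - 1 / δ` suffices: `B = A / d` adds just `-½ log d`.
  have hlog : ‖(fun j => Real.log ‖z' j‖) - x₀‖ ≤ A / d := by
    refine (norm_sub_le _ _).trans ?_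
    have hj : ‖fun j => Real.log ‖z' j‖‖ ≤ Real.log R + 1 / δ := by
      refine (pi_norm_le_iff_of_nonneg (by positivity)).2 fun j => ?_
      have h1 : Real.log ‖z' j‖ ≤ Real.log R :=
        Real.log_le_log (hz'0 j) ((PiLp.norm_apply_le z' j).trans hz'R)
      have h2 : -(1 / δ) ≤ Real.log ‖z' j‖ := by
        have h3 := Real.log_le_log hδ0 (hz' j)
        have h4 := Real.one_sub_inv_le_log_of_pos hδ0
        rw [one_div]
        linarith
      have h5 : 0 ≤ 1 / δ := by positivity
      rw [Real.norm_eq_abs, abs_le]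
      constructor <;> linarith
    have h6 : 1 / δ = 4 * (n + 1) / d := by rw [hδ]; field_simp
    have h7 : Real.log R + ‖x₀‖ ≤ (Real.log R + ‖x₀‖) / d := by
      rw [le_div_iff₀ hd]
      nlinarith [norm_nonneg x₀]
    have h8 : A / d = (Real.log R + ‖x₀‖) / d + 4 * (n + 1) / d := by rw [hA]; ring
    rw [h6] at hj
    linarith
  have h1 := hC z' hz'D (fun j => norm_pos_iff.1 (hz'0 j)) hz'R
    ((bdist_le_norm_sub hζ₀ z').trans hz'ζ) (A / d) hAd hlog
  have h2 := (KobBound.of_ball hR.1 hd hball hzz').symm hR.1 hz hz'D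
  have h3 := Real.log_le_log (by positivity) hd'
  rw [Real.log_div hd.ne' (by norm_num)] at h3
  rw [Real.log_div (by positivity) hd.ne'] at h1
  refine KobBound.kobayashi_le ?_ ((h1.trans hR.1 hz₀ hz'D hz h2).mono ?_)
  · have := Real.log_nonpos hd.le (by linarith)
    linarith [le_max_right C' 0]
  · linarith [le_max_left C' 0]

open KobReinhardt in
theorem KobReinhardt.kobayashi_le_neg_half_log {n : ℕ} {D : Set (Cn n)}
    (hR : IsReinhardtDomain D) (hP : IsPseudoconvex D) {z₀ : Cn n} (hz₀ : z₀ ∈ D) {ζ₀ : Cn n}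
    (hζ₀ : ζ₀ ∈ frontier D) (h0 : ∀ j, ζ₀ j ≠ 0) : ∃ C : ℝ, ∀ᶠ z in 𝓝[D] ζ₀,
      ((kobayashi D z₀ z : ℝ≥0∞) : EReal) ≤
        ((-(1 / 2) * Real.log (bdist D z) + C : ℝ) : EReal) := by
  have hf : (frontier D).Nonempty := ⟨ζ₀, hζ₀⟩
  obtain ⟨x₀, hx₀⟩ := hR.exists_mem_logImage hf hz₀
  obtain ⟨C, hC⟩ := hR.exists_kobBound hP hf hz₀ hx₀ (‖ζ₀‖ + 1)
  set B := ‖(fun j => Real.log ‖ζ₀ j‖) - x₀‖ + 1 with hB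
  have hB1 : 1 ≤ B := by linarith [norm_nonneg ((fun j => Real.log ‖ζ₀ j‖) - x₀)]
  set C' := 1 / 2 * Real.log B + C with hC'
  have hne : ∀ᶠ z : Cn n in 𝓝 ζ₀, ∀ j, z j ≠ 0 := Filter.eventually_all.2 fun j =>
    ContinuousAt.eventually_ne (by fun_prop) (h0 j)
  -- Nonzero coordinates of `ζ₀` keep the logarithms bounded near it, so `B` is a constant.
  have hlog : ∀ᶠ z : Cn n in 𝓝 ζ₀, ‖(fun j => Real.log ‖z j‖) - x₀‖ < B := by
    refine ContinuousAt.eventually_lt ?_ continuousAt_const (by linarith)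
    refine ContinuousAt.norm (ContinuousAt.sub (continuousAt_pi.2 fun j => ?_) continuousAt_const)
    exact ContinuousAt.log (by fun_prop) (norm_ne_zero_iff.2 (h0 j))
  refine ⟨max C' 0, ?_⟩
  filter_upwards [self_mem_nhdsWithin, mem_nhdsWithin_of_mem_nhds hne,
    mem_nhdsWithin_of_mem_nhds hlog, mem_nhdsWithin_of_mem_nhds
    (Metric.closedBall_mem_nhds ζ₀ one_pos)] with z hz hz0 hzB hzζ
  rw [Metric.mem_closedBall, dist_eq_norm] at hzζ
  have hd := bdist_pos hz hR.1.1 hf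
  have hd1 := (bdist_le_norm_sub hζ₀ z).trans hzζ
  have hzR : ‖z‖ ≤ ‖ζ₀‖ + 1 := by
    have := norm_add_le (z - ζ₀) ζ₀
    rw [sub_add_cancel] at this
    linarith
  refine KobBound.kobayashi_le ?_ ((hC z hz hz0 hzR hd1 B hB1 hzB.le).mono ?_)
  · have := Real.log_nonpos hd.le hd1
    linarith [le_max_right C' 0]
  · linarith [le_max_left C' 0]

theorem theorem1 (n : ℕ) (D : Set (KobReinhardt.Cn n))
    (hR : KobReinhardt.IsReinhardtDomain D) (hP : KobReinhardt.IsPseudoconvex D)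
    (z₀ : KobReinhardt.Cn n) (hz₀ : z₀ ∈ D)
    (ζ₀ : KobReinhardt.Cn n) (hζ₀ : ζ₀ ∈ frontier D) :
    (∃ C : ℝ, ∀ᶠ z in 𝓝[D] ζ₀,
      ((KobReinhardt.kobayashi D z₀ z : ℝ≥0∞) : EReal) ≤
        ((-Real.log (KobReinhardt.bdist D z) + C : ℝ) : EReal)) ∧
    ((∀ j : Fin n, ζ₀ j ≠ 0) →
      ∃ C' : ℝ, ∀ᶠ z in 𝓝[D] ζ₀,
        ((KobReinhardt.kobayashi D z₀ z : ℝ≥0∞) : EReal) ≤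
          ((-(1 / 2) * Real.log (KobReinhardt.bdist D z) + C' : ℝ) : EReal)) :=
  ⟨KobReinhardt.kobayashi_le_neg_log hR hP hz₀ hζ₀,
    fun h0 => KobReinhardt.kobayashi_le_neg_half_log hR hP hz₀ hζ₀ h0⟩
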